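/- A polymatroid is a pair $(Q,f)$ with $Q$ a finite set and $f\colon 2^Q\to\mathbb R$ satisfying $f(\emptyset)=0$, $f(X)\le f(Y)$ for $X\subseteq Y$, and $f(X\cap Y)+f(X\cup Y)\le f(X)+f(Y)$. A matroid is identified with the polymatroid given by its rank function. Write $f(Y{:}Z|X)=f(X\cup Y)+f(X\cup Z)-f(X\cup Y\cup Z)-f(X)$, $f(Y{:}Z)=f(Y{:}Z|\emptyset)$ and $f(Y|X)=f(X\cup Y)-f(X)$. The polymatroid $(Q,f)$ is Ingleton-compliant if $f(A_2{:}A_3)\le f(A_2{:}A_3|A_1)+f(A_2{:}A_3|A_4)+f(A_1{:}A_4)$ for all $A_1,A_2,A_3,A_4\subseteq Q$. It is $1$-CI-compliant if for all $A,B\subseteq Q$ there is a polymatroid $(Q\cup\{x_o\},f)$ extending it, with one new point $x_o$, such that $f(x_o|A)=f(x_o|B)=0$ and $f(x_o)=f(A{:}B)$. For $k>1$ it is $k$-CI-compliant if for all $A,B\subseteq Q$ such an extension exists that is moreover $(k-1)$-CI-compliant. It is CI-compliant if it is $k$-CI-compliant for every $k\ge 1$. A matroid $(Q,r)$ is folded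 linear if there are a positive integer $\ell$, a field $\mathbb F$, a finite-dimensional $\mathbb F$-vector space $V$ and subspaces $(V_x)_{x\in Q}$ of $V$ such that $\ell\, r(X)=\dim\sum_{x\in X}V_x$ for all $X\subseteq Q$. A matroid of rank $k$ is sparse paving if every circuit has rank $k$ or $k-1$ and every circuit of rank $k-1$ is a flat; the circuits of rank $k-1$ are then its circuit-hyperplanes. A sparse paving matroid is determined by its ground set, its rank and its circuit-hyperplanes. Let $Q=\{0,1,2\}\times\{0,1,2\}$ and $C_{ab}=\{(i,j)\in Q: i=a\text{ or }j=b\}$. The tic-tac-toe matroid is the sparse paving matroid of rank $5$ on $Q$ whose circuit-hyperplanes are the eight sets $C_{ab}$ with $(a,b)\neq(1,1)$. Theorem. The table in the formal statement below lists 171 families of $5$-element subsets of $Q$, each of them containing the eight sets $C_{ab}$ with $(a,b)\ne(1,1)$. Each family is the set of circuit-hyperplanes of a sparse paving matroid of rank $5$ on the nine points of $Q$. The 171 matroids obtained in this way are pairwise non-isomorphic, and the first one is the tic-tac-toe matroid. All of them are Ingleton-compliant, none of them is CI-compliant, and hence none of them is folded linear. -/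

import Mathlib

open Finset

universe u v

/-! ### Polymatroids, given by their rank functions -/

/-- `f` is the rank function of a polymatroid with ground set `Q`. -/
structure IsPolymatroid {Q : Type u} [DecidableEq Q] (f : Finset Q → ℝ) : Prop where
  map_empty : f ∅ = 0
  mono : ∀ X Y : Finset Q, X ⊆ Y → f X ≤ f Y
  submodular : ∀ X Y : Finset Q, f (X ∩ Y) + f (X ∪ Y) ≤ f X + f Y

/-- `f(Y : Z | X) = f(XY) + f(XZ) - f(XYZ) - f(X)`. -/
def condMutual {Q : Type u} [DecidableEq Q] (f : Finset Q → ℝ) (Y Z X : Finset Q) : ℝ :=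
  f (X ∪ Y) + f (X ∪ Z) - f (X ∪ Y ∪ Z) - f X

/-- `f(Y : Z) = f(Y : Z | ∅)`. -/
def mutualRank {Q : Type u} [DecidableEq Q] (f : Finset Q → ℝ) (Y Z : Finset Q) : ℝ :=
  condMutual f Y Z ∅

/-- `f(Y | X) = f(Y : Y | X)`, which equals `f(XY) - f(X)`. -/
def condRank {Q : Type u} [DecidableEq Q] (f : Finset Q → ℝ) (Y X : Finset Q) : ℝ :=
  condMutual f Y Y X

/-- Ingleton's inequality holds for all choices of four subsets of the ground set. -/
def IsIngletonCompliant {Q : Type u} [DecidableEq Q] (f : Finset Q → ℝ) : Prop :=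
  ∀ A₁ A₂ A₃ A₄ : Finset Q,
    mutualRank f A₂ A₃ ≤ condMutual f A₂ A₃ A₁ + condMutual f A₂ A₃ A₄ + mutualRank f A₁ A₄

/-- The set `Xo` is a common information for the pair `(A, B)`. -/
def IsCommonInfo {Q : Type u} [DecidableEq Q] (f : Finset Q → ℝ) (A B Xo : Finset Q) : Prop :=
  condRank f Xo A = 0 ∧ condRank f Xo B = 0 ∧ f Xo = mutualRank f A B

/-- The polymatroid `f'` on `Q` together with one new point `none` extends `f`. -/
def IsOnePointExtension {Q : Type u} [DecidableEq Q] (f : Finset Q → ℝ)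
    (f' : Finset (Option Q) → ℝ) : Prop :=
  IsPolymatroid f' ∧ ∀ X : Finset Q, f' (X.map Function.Embedding.some) = f X

/-- `k`-CI-compliance for `k ≥ 1`; the value at `k = 0` is the empty condition, so that
`1`-CI-compliance only asks for the existence of the extensions. -/
def IsKCICompliant : (k : ℕ) → {Q : Type u} → [DecidableEq Q] → (Finset Q → ℝ) → Prop
  | 0, _, _, _ => True
  | k + 1, Q, _, f => ∀ A B : Finset Q, ∃ f' : Finset (Option Q) → ℝ,
      IsOnePointExtension f f' ∧
      IsCommonInfo f' (A.map Function.Embedding.some) (B.map Function.Embedding.some) {none} ∧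
      IsKCICompliant k f'

/-- CI-compliance: `k`-CI-compliance for every positive integer `k`. -/
def IsCICompliant {Q : Type u} [DecidableEq Q] (f : Finset Q → ℝ) : Prop :=
  ∀ k : ℕ, 1 ≤ k → IsKCICompliant k f

/-- `f(X) = dim ∑_{x ∈ X} V_x` for a family of subspaces of a finite-dimensional space. -/
def IsLinearPolymatroid (F : Type v) [Field F] {Q : Type u} (f : Finset Q → ℝ) : Prop :=
  ∃ (V : Type v) (_ : AddCommGroup V) (_ : Module F V) (_ : Module.Finite F V)
    (W : Q → Submodule F V),
    ∀ X : Finset Q, f X = (Module.finrank F (⨆ x ∈ X, W x : Submodule F V) : ℝ)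

/-- The matroid with rank function `r` is folded linear: for some field and some positive
integer `ℓ`, the polymatroid with rank function `ℓ r` is linear over that field. -/
def IsFoldedLinear {Q : Type u} (r : Finset Q → ℝ) : Prop :=
  ∃ (F : Type v) (_ : Field F) (ℓ : ℕ), 0 < ℓ ∧
    IsLinearPolymatroid F (fun X => (ℓ : ℝ) * r X)

/-! ### Matroids -/

namespace Matroid

/-- The real-valued rank function of a matroid on a finite ground set. -/
noncomputable def realRank {α : Type u} (M : Matroid α) (X : Finset α) : ℝ :=
  ((M.eRk (X : Set α)).toNat : ℝ)

/-- Every circuit has rank `k` or `k - 1`, where `k` is the rank of the matroid. -/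
def IsPaving {α : Type u} (M : Matroid α) : Prop :=
  ∀ C : Set α, M.IsCircuit C → M.eRk C = M.eRank ∨ M.eRk C + 1 = M.eRank

/-- Paving, and all circuits of rank `k - 1` are flats. -/
def IsSparsePaving {α : Type u} (M : Matroid α) : Prop :=
  M.IsPaving ∧ ∀ C : Set α, M.IsCircuit C → M.eRk C + 1 = M.eRank → M.IsFlat C

/-- A circuit that is also a flat of rank `k - 1`. -/
def IsCircuitHyperplane {α : Type u} (M : Matroid α) (C : Set α) : Prop :=
  M.IsCircuit C ∧ M.IsFlat C ∧ M.eRk C + 1 = M.eRank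

/-- Two matroids on full ground types are isomorphic. -/
def IsIsomorphic {α : Type u} {β : Type v} (M : Matroid α) (N : Matroid β) : Prop :=
  ∃ e : α ≃ β, M.mapEquiv e = N

end Matroid

/-! ### The list of 171 matroids -/

/-- The nine points: the cells of a `3 × 3` grid. -/
abbrev Cell : Type := Fin 3 × Fin 3

/-- The union of row `a` and column `b`, where `p = (a, b)`; a set of five cells. -/
def cross (p : Cell) : Finset Cell :=
  univ.filter fun q => q.1 = p.1 ∨ q.2 = p.2

/-- The circuit-hyperplanes of the tic-tac-toe matroid: all crosses but the central one. -/
def ticTacToe : Finset (Finset Cell) :=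
  (univ.filter fun p : Cell => p ≠ (1, 1)).image cross

/-- The set of cells coded by a natural number: cell `(i, j)` is in it if the binary digit of
weight `2 ^ (3 * i + j)` is `1`. -/
def cellsOf (m : ℕ) : Finset Cell :=
  univ.filter fun q => m.testBit (3 * q.1.val + q.2.val) = true

/-- Each of the 171 matroids is written on the grid so that the circuit-hyperplanes of the
tic-tac-toe matroid are among its circuit-hyperplanes; this table lists the codes of its further
circuit-hyperplanes. The first entry is the tic-tac-toe matroid itself. -/
def furtherCodes : List (List ℕ) :=
  [[], [118], [171], [173], [341], [118, 171], [118, 173], [118, 174], [118, 220], [118, 227],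
   [118, 234], [118, 283], [118, 341], [171, 341], [171, 362], [173, 227], [173, 341],
   [173, 362], [118, 171, 220], [118, 171, 283], [118, 171, 341], [118, 171, 362],
   [118, 171, 398], [118, 171, 433], [118, 173, 220], [118, 173, 227], [118, 173, 234],
   [118, 173, 283], [118, 173, 341], [118, 173, 362], [118, 173, 398], [118, 173, 433],
   [118, 174, 220], [118, 174, 227], [118, 174, 341], [118, 220, 283], [118, 220, 341],
   [118, 227, 341], [118, 227, 362], [118, 227, 433], [118, 234, 341], [118, 283, 341],
   [171, 341, 362], [171, 362, 398], [173, 227, 341], [173, 227, 362], [173, 341, 362],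
   [118, 171, 220, 283], [118, 171, 220, 341], [118, 171, 220, 362], [118, 171, 220, 433],
   [118, 171, 283, 341], [118, 171, 283, 362], [118, 171, 283, 398], [118, 171, 283, 433],
   [118, 171, 341, 362], [118, 171, 341, 398], [118, 171, 341, 433], [118, 171, 362, 398],
   [118, 171, 362, 433], [118, 171, 398, 433], [118, 173, 220, 227], [118, 173, 220, 234],
   [118, 173, 220, 283], [118, 173, 220, 341], [118, 173, 220, 362], [118, 173, 220, 398],
   [118, 173, 220, 433], [118, 173, 227, 283], [118, 173, 227, 341], [118, 173, 227, 362],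
   [118, 173, 227, 398], [118, 173, 227, 433], [118, 173, 234, 341], [118, 173, 234, 398],
   [118, 173, 283, 341], [118, 173, 283, 362], [118, 173, 341, 362], [118, 173, 341, 398],
   [118, 173, 341, 433], [118, 173, 362, 433], [118, 174, 227, 341], [118, 174, 227, 362],
   [118, 220, 283, 341], [118, 220, 283, 433], [118, 227, 341, 362], [118, 227, 341, 433],
   [171, 341, 362, 398], [173, 227, 341, 362], [173, 227, 362, 398], [118, 171, 220, 283, 341],
   [118, 171, 220, 283, 362], [118, 171, 220, 283, 433], [118, 171, 220, 341, 362],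
   [118, 171, 220, 341, 433], [118, 171, 220, 362, 398], [118, 171, 220, 362, 433],
   [118, 171, 283, 341, 362], [118, 171, 283, 341, 398], [118, 171, 283, 362, 398],
   [118, 171, 283, 362, 433], [118, 171, 283, 398, 433], [118, 171, 341, 362, 398],
   [118, 171, 341, 362, 433], [118, 171, 341, 398, 433], [118, 171, 362, 398, 433],
   [118, 173, 220, 227, 283], [118, 173, 220, 227, 341], [118, 173, 220, 227, 362],
   [118, 173, 220, 227, 433], [118, 173, 220, 234, 398], [118, 173, 220, 283, 341],
   [118, 173, 220, 283, 362], [118, 173, 220, 283, 398], [118, 173, 220, 283, 433],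
   [118, 173, 220, 341, 362], [118, 173, 220, 341, 398], [118, 173, 220, 341, 433],
   [118, 173, 227, 283, 341], [118, 173, 227, 283, 362], [118, 173, 227, 283, 398],
   [118, 173, 227, 341, 362], [118, 173, 227, 341, 398], [118, 173, 227, 341, 433],
   [118, 173, 227, 362, 398], [118, 173, 227, 362, 433], [118, 173, 234, 341, 398],
   [118, 173, 283, 341, 362], [118, 173, 341, 362, 433], [118, 174, 227, 341, 362],
   [118, 220, 283, 341, 433], [173, 227, 341, 362, 398], [118, 171, 220, 283, 341, 362],
   [118, 171, 220, 283, 362, 398], [118, 171, 220, 283, 362, 433],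
   [118, 171, 220, 341, 362, 398], [118, 171, 220, 341, 362, 433],
   [118, 171, 220, 362, 398, 433], [118, 171, 283, 341, 362, 398],
   [118, 171, 283, 362, 398, 433], [118, 171, 341, 362, 398, 433],
   [118, 173, 220, 227, 283, 341], [118, 173, 220, 227, 283, 362],
   [118, 173, 220, 227, 283, 433], [118, 173, 220, 227, 341, 362],
   [118, 173, 220, 227, 341, 433], [118, 173, 220, 227, 362, 398],
   [118, 173, 220, 227, 362, 433], [118, 173, 220, 283, 341, 362],
   [118, 173, 220, 283, 341, 398], [118, 173, 220, 283, 341, 433],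
   [118, 173, 220, 283, 362, 433], [118, 173, 227, 283, 341, 362],
   [118, 173, 227, 283, 341, 398], [118, 173, 227, 283, 362, 398],
   [118, 173, 227, 341, 362, 398], [118, 173, 227, 341, 362, 433],
   [118, 171, 220, 283, 341, 362, 398], [118, 171, 220, 283, 362, 398, 433],
   [118, 171, 220, 341, 362, 398, 433], [118, 173, 220, 227, 283, 341, 362],
   [118, 173, 220, 227, 283, 341, 433], [118, 173, 220, 227, 283, 362, 398],
   [118, 173, 220, 227, 283, 362, 433], [118, 173, 220, 227, 341, 362, 398],
   [118, 173, 220, 227, 341, 362, 433], [118, 173, 220, 283, 341, 362, 433],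
   [118, 173, 227, 283, 341, 362, 398], [118, 173, 220, 227, 283, 341, 362, 398],
   [118, 173, 220, 227, 283, 362, 398, 433], [118, 173, 220, 227, 283, 341, 362, 398, 433]]

theorem furtherCodes_length : furtherCodes.length = 171 := by
  rfl

/-- The circuit-hyperplanes of the `k`-th matroid of the list. -/
def listedCircuitHyperplanes (k : Fin 171) : Finset (Finset Cell) :=
  ticTacToe ∪ ((furtherCodes.get (k.cast furtherCodes_length.symm)).map cellsOf).toFinset

/-!
In a sparse paving matroid of rank `d` Ingleton's inequality for `A₁, …, A₄` follows from
submodularity unless all pairs except `A₁, A₄` have a circuit-hyperplane as their union. If it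
fails then, `A₂` and `A₃` have `d - 2` elements, and the five circuit-hyperplanes form a Vámos
configuration.

In an extension of the tic-tac-toe matroid let `q` and `s` be common informations of row 0 with
rows 1 and 2. Two rows span, and a row and a column other than the two middle ones have rank 4, so
submodularity makes columns 0 and 2 determine `q` and `s`. These columns have rank 3 and span
together, hence `q` and `s` together have rank 1, and `q` determines `s`. Thus both row 1 and
column 1 determine `s` and the central cell. They have rank 3 and span together as well, the central
cross being independent, so `s`, and with it row 0, determines the central cell, which is absurd.
This uses two successive extensions. A linear polymatroid extends by intersections of spans as often
as desired, and scaling by `1 / ℓ` passes this on to folded linear matroids.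

An isomorphism maps circuit-hyperplanes to circuit-hyperplanes, so it preserves any count of the
ways in which these cover the ground set; a suitable count takes 171 different values.
-/

/-! ### Sparse paving matroids -/

/-- A family of `d`-element sets, any two of which differ in at least two elements: the possible
families of circuit-hyperplanes of a sparse paving matroid of rank `d`. -/
structure IsSparseFamily {α : Type u} [DecidableEq α] (d : ℕ) (H : Finset (Finset α)) : Prop where
  pos : 0 < d
  card_eq : ∀ A ∈ H, A.card = d
  card_inter_add_two_le : ∀ A ∈ H, ∀ B ∈ H, A ≠ B → (A ∩ B).card + 2 ≤ d

namespace IsSparseFamily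

variable {α : Type u} [DecidableEq α] {d : ℕ} {H : Finset (Finset α)}

theorem notMem_of_card_ne (hH : IsSparseFamily d H) {X : Finset α} (hX : X.card ≠ d) : X ∉ H :=
  fun h => hX (hH.card_eq X h)

theorem eq_of_subset (hH : IsSparseFamily d H) {A B S : Finset α} (hA : A ∈ H) (hB : B ∈ H)
    (hSA : S ⊆ A) (hSB : S ⊆ B) (hS : d < S.card + 2) : A = B := by
  by_contra hne
  have h₁ := hH.card_inter_add_two_le A hA B hB hne
  have h₂ := card_le_card (subset_inter hSA hSB)
  omega

theorem inter_eq_of_subset (hH : IsSparseFamily d H) {A B S : Finset α} (hA : A ∈ H) (hB : B ∈ H)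
    (hne : A ≠ B) (hSA : S ⊆ A) (hSB : S ⊆ B) (hS : S.card + 2 = d) : A ∩ B = S := by
  have h := hH.card_inter_add_two_le A hA B hB hne
  exact (eq_of_subset_of_card_le (subset_inter hSA hSB) (by omega)).symm

theorem exists_insert_notMem (hH : IsSparseFamily d H) {I X : Finset α}
    (h : 1 < (X \ I).card) : ∃ e ∈ X, e ∉ I ∧ insert e I ∉ H := by
  obtain ⟨a, ha, b, hb, hab⟩ := one_lt_card.1 h
  rw [mem_sdiff] at ha hb
  by_cases haH : insert a I ∈ H
  · refine ⟨b, hb.1, hb.2, fun hbH => ?_⟩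
    have hd := hH.card_eq _ haH
    rw [card_insert_of_notMem ha.2] at hd
    have heq := hH.eq_of_subset haH hbH (subset_insert a I) (subset_insert b I) (by omega)
    have : a ∈ insert b I := heq ▸ mem_insert_self a I
    exact (mem_insert.1 this).elim hab ha.2
  · exact ⟨a, ha.1, ha.2, haH⟩

theorem exists_insert_of_card_lt (hH : IsSparseFamily d H) {I J : Finset α} (hJ : J.card ≤ d)
    (hJH : J ∉ H) (hlt : I.card < J.card) : ∃ e ∈ J, e ∉ I ∧ insert e I ∉ H := by
  by_cases hIJ : I ⊆ J
  · obtain ⟨e, heJ, heI⟩ := exists_mem_notMem_of_card_lt_card hlt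
    refine ⟨e, heJ, heI, fun h => hJH ?_⟩
    rwa [← eq_of_subset_of_card_le (insert_subset heJ hIJ) (hJ.trans_eq (hH.card_eq _ h).symm)]
  · have h₁ : (J ∩ I).card < I.card := card_lt_card
      ⟨inter_subset_right, fun h => hIJ (h.trans inter_subset_left)⟩
    have h₂ := card_sdiff_add_card_inter J I
    exact hH.exists_insert_notMem (by omega)

theorem exists_subset_card_eq_min (hH : IsSparseFamily d H) {X : Finset α} (hX : X ∉ H) :
    ∃ I ⊆ X, I ∉ H ∧ I.card = min X.card d := by
  rcases le_or_gt X.card d with hd | hd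
  · exact ⟨X, Subset.rfl, hX, (min_eq_left hd).symm⟩
  have hpos := hH.pos
  obtain ⟨J, hJX, hJ⟩ := exists_subset_card_eq (show d - 1 ≤ X.card by omega)
  have hcard : 1 < (X \ J).card := by rw [card_sdiff_of_subset hJX]; omega
  obtain ⟨e, heX, heJ, heH⟩ := hH.exists_insert_notMem hcard
  exact ⟨insert e J, insert_subset heX hJX, heH, by rw [card_insert_of_notMem heJ]; omega⟩

/-- The sparse paving matroid of rank `d` with circuit-hyperplanes `H`, defined by its independent
sets: the sets of at most `d` elements that are not in `H`. -/
def matroid (hH : IsSparseFamily d H) : Matroid α :=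
  (IndepMatroid.ofFinset Set.univ (fun I => I.card ≤ d ∧ I ∉ H)
    ⟨by simp, hH.notMem_of_card_ne (by simpa using hH.pos.ne)⟩
    (by
      rintro I J ⟨hJ, hJH⟩ hIJ
      refine ⟨(card_le_card hIJ).trans hJ, fun hI => hJH ?_⟩
      rwa [← eq_of_subset_of_card_le hIJ (hJ.trans_eq (hH.card_eq _ hI).symm)])
    (by
      rintro I J - ⟨hJ, hJH⟩ hlt
      obtain ⟨e, heJ, heI, heH⟩ := hH.exists_insert_of_card_lt hJ hJH hlt
      exact ⟨e, heJ, heI, by rw [card_insert_of_notMem heI]; omega, heH⟩)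
    (by simp)).matroid

theorem matroid_indep_iff (hH : IsSparseFamily d H) {I : Finset α} :
    hH.matroid.Indep (I : Set α) ↔ I.card ≤ d ∧ I ∉ H := by
  simp only [matroid, IndepMatroid.matroid_Indep, IndepMatroid.ofFinset_indep]

theorem mem_iff_not_indep (hH : IsSparseFamily d H) {C : Finset α} (hC : C.card ≤ d) :
    C ∈ H ↔ ¬ hH.matroid.Indep (C : Set α) := by
  rw [hH.matroid_indep_iff, not_and_not_right, forall_prop_of_true hC]

theorem isCircuit_of_mem (hH : IsSparseFamily d H) {C : Finset α} (hC : C ∈ H) :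
    hH.matroid.IsCircuit (C : Set α) := by
  rw [Matroid.isCircuit_iff_dep_forall_sdiff_singleton_indep]
  refine ⟨⟨(hH.mem_iff_not_indep (hH.card_eq C hC).le).1 hC, Set.subset_univ _⟩, fun e he => ?_⟩
  have hlt : (C.erase e).card < d := hH.card_eq C hC ▸ card_erase_lt_of_mem he
  rw [← coe_erase, hH.matroid_indep_iff]
  exact ⟨hlt.le, hH.notMem_of_card_ne hlt.ne⟩

theorem mem_of_isCircuit (hH : IsSparseFamily d H) {C : Finset α}
    (hC : hH.matroid.IsCircuit (C : Set α)) (hd : C.card ≤ d) : C ∈ H :=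
  (hH.mem_iff_not_indep hd).2 hC.dep.not_indep

theorem eRk_add_one_of_mem (hH : IsSparseFamily d H) {C : Finset α} (hC : C ∈ H) :
    hH.matroid.eRk (C : Set α) + 1 = d := by
  rw [(hH.isCircuit_of_mem hC).eRk_add_one_eq, Set.encard_coe_eq_coe_finsetCard, hH.card_eq C hC]

theorem eRk_le (hH : IsSparseFamily d H) (X : Finset α) : hH.matroid.eRk (X : Set α) ≤ d := by
  refine Matroid.eRk_le_iff.2 fun I hIX hI => ?_
  lift I to Finset α using X.finite_toSet.subset hIX
  rw [Set.encard_coe_eq_coe_finsetCard]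
  exact_mod_cast (hH.matroid_indep_iff.1 hI).1

theorem eRk_of_notMem (hH : IsSparseFamily d H) {X : Finset α} (hX : X ∉ H) :
    hH.matroid.eRk (X : Set α) = (min X.card d : ℕ) := by
  apply le_antisymm
  · rw [Monotone.map_min (f := ((↑) : ℕ → ℕ∞)) Nat.mono_cast, le_min_iff,
      ← Set.encard_coe_eq_coe_finsetCard]
    exact ⟨hH.matroid.eRk_le_encard X, hH.eRk_le X⟩
  · obtain ⟨I, hIX, hIH, hI⟩ := hH.exists_subset_card_eq_min hX
    rw [← hI, ← Set.encard_coe_eq_coe_finsetCard]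
    have hind := hH.matroid_indep_iff.2 ⟨hI.trans_le (min_le_right _ _), hIH⟩
    exact hind.encard_le_eRk_of_subset (coe_subset.2 hIX)

theorem eRk_of_lt_card (hH : IsSparseFamily d H) {X : Finset α} (hX : d < X.card) :
    hH.matroid.eRk (X : Set α) = d := by
  rw [hH.eRk_of_notMem (hH.notMem_of_card_ne hX.ne'), min_eq_right hX.le]

theorem eRank_matroid [Fintype α] (hH : IsSparseFamily d H) (hd : d < Fintype.card α) :
    hH.matroid.eRank = d := by
  have hE : ((univ : Finset α) : Set α) = hH.matroid.E := coe_univ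
  rw [← Matroid.eRk_ground, ← hE, hH.eRk_of_lt_card (by rwa [card_univ])]

theorem isFlat_of_mem (hH : IsSparseFamily d H) {C : Finset α} (hC : C ∈ H) :
    hH.matroid.IsFlat (C : Set α) := by
  have hsub := hH.matroid.subset_closure (C : Set α) (hH.isCircuit_of_mem hC).subset_ground
  rw [Matroid.isFlat_iff_closure_eq]
  refine hsub.antisymm' fun x hx => ?_
  by_contra hxC
  have hcard : d < (insert x C).card := by
    rw [card_insert_of_notMem (mt mem_coe.2 hxC), hH.card_eq C hC]
    exact Nat.lt_succ_self d
  have hle : hH.matroid.eRk (insert x C : Finset α) ≤ hH.matroid.eRk (C : Set α) := by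
    rw [← Matroid.eRk_closure_eq _ (C : Set α), coe_insert]
    exact Matroid.eRk_mono _ (Set.insert_subset hx hsub)
  rw [hH.eRk_of_lt_card hcard, ← hH.eRk_add_one_of_mem hC] at hle
  have hfin := ne_top_of_le_ne_top (ENat.natCast_ne_top d) (hH.eRk_le C)
  exact ((ENat.add_one_le_iff hfin).1 hle).false

theorem exists_mem_or_eRk_eq_of_isCircuit [Finite α] (hH : IsSparseFamily d H) {C : Set α}
    (hC : hH.matroid.IsCircuit C) : (∃ A ∈ H, C = A) ∨ hH.matroid.eRk C = d := by
  obtain ⟨A, rfl⟩ := C.toFinite.exists_finset_coe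
  rcases le_or_gt A.card d with hA | hA
  · exact .inl ⟨A, hH.mem_of_isCircuit hC hA, rfl⟩
  · exact .inr (hH.eRk_of_lt_card hA)

variable [Fintype α]

theorem isSparsePaving (hH : IsSparseFamily d H) (hd : d < Fintype.card α) :
    hH.matroid.IsSparsePaving := by
  rw [Matroid.IsSparsePaving, Matroid.IsPaving, hH.eRank_matroid hd]
  refine ⟨fun C hC => ?_, fun C hC hr => ?_⟩
  · rcases hH.exists_mem_or_eRk_eq_of_isCircuit hC with ⟨A, hA, rfl⟩ | h
    · exact .inr (hH.eRk_add_one_of_mem hA)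
    · exact .inl h
  · rcases hH.exists_mem_or_eRk_eq_of_isCircuit hC with ⟨A, hA, rfl⟩ | h
    · exact hH.isFlat_of_mem hA
    · rw [h] at hr
      norm_cast at hr
      omega

theorem isCircuitHyperplane_iff (hH : IsSparseFamily d H) (hd : d < Fintype.card α)
    {C : Finset α} : hH.matroid.IsCircuitHyperplane (C : Set α) ↔ C ∈ H := by
  rw [Matroid.IsCircuitHyperplane, hH.eRank_matroid hd]
  refine ⟨fun ⟨hC, _, hr⟩ => ?_, fun h =>
    ⟨hH.isCircuit_of_mem h, hH.isFlat_of_mem h, hH.eRk_add_one_of_mem h⟩⟩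
  rcases hH.exists_mem_or_eRk_eq_of_isCircuit hC with ⟨A, hA, hCA⟩ | h
  · rwa [coe_injective hCA]
  · rw [h] at hr
    norm_cast at hr
    omega

end IsSparseFamily

theorem IsSparseFamily.exists_equiv_of_isIsomorphic {α : Type u} {β : Type v} [DecidableEq α]
    [DecidableEq β] {d : ℕ} {H : Finset (Finset α)} {H' : Finset (Finset β)}
    (hH : IsSparseFamily d H) (hH' : IsSparseFamily d H')
    (h : hH.matroid.IsIsomorphic hH'.matroid) :
    ∃ e : α ≃ β, H' = H.map (mapEmbedding e.toEmbedding).toEmbedding := by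
  obtain ⟨e, he⟩ := h
  have hmem : ∀ A : Finset α, A.card = d → (A.map e.toEmbedding ∈ H' ↔ A ∈ H) := fun A hA => by
    rw [hH.mem_iff_not_indep hA.le, hH'.mem_iff_not_indep (by rw [card_map, hA]), ← he,
      Matroid.mapEquiv_indep_iff, coe_map, Equiv.coe_toEmbedding, Equiv.symm_image_image]
  refine ⟨e, ext fun C => ?_⟩
  obtain ⟨A, rfl⟩ := e.finsetCongr.surjective C
  simp only [Equiv.finsetCongr_apply, mem_map, RelEmbedding.coe_toEmbedding, mapEmbedding_apply,
    map_inj, exists_eq_right]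
  by_cases hA : A.card = d
  · exact hmem A hA
  · exact iff_of_false (hH'.notMem_of_card_ne (by rwa [card_map])) (hH.notMem_of_card_ne hA)

/-! ### Ingleton's inequality -/

/-- Ingleton's inequality with inner pair `B, C` and outer pair `A, D`, in terms of the ranks of
the pairwise unions. -/
def IngletonAt {Q : Type u} [DecidableEq Q] (f : Finset Q → ℝ) (A B C D : Finset Q) : Prop :=
  f B + f C + f (A ∪ B ∪ C) + f (D ∪ B ∪ C) + f (A ∪ D) ≤
    f (A ∪ B) + f (A ∪ C) + f (D ∪ B) + f (D ∪ C) + f (B ∪ C)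

section Ingleton

variable {Q : Type u} [DecidableEq Q] {f : Finset Q → ℝ} {A B C D : Finset Q}

namespace IngletonAt

theorem swap_inner (h : IngletonAt f A C B D) : IngletonAt f A B C D := by
  simp only [IngletonAt] at *
  rw [union_right_comm A C B, union_right_comm D C B, union_comm C B] at h
  linarith

theorem swap_outer (h : IngletonAt f D B C A) : IngletonAt f A B C D := by
  simp only [IngletonAt] at *
  rw [union_comm D A] at h
  linarith

end IngletonAt

namespace IsPolymatroid

theorem isIngletonCompliant (hf : IsPolymatroid f) (h : ∀ A B C D, IngletonAt f A B C D) :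
    IsIngletonCompliant f := by
  intro A B C D
  have hABCD := h A B C D
  simp only [IngletonAt] at hABCD
  simp only [mutualRank, condMutual, empty_union, hf.map_empty]
  linarith

theorem submodular_of_subset (hf : IsPolymatroid f) {X Y Z W : Finset Q} (hZ : Z ⊆ X ∩ Y)
    (hW : W ⊆ X ∪ Y) : f Z + f W ≤ f X + f Y :=
  (add_le_add (hf.mono _ _ hZ) (hf.mono _ _ hW)).trans (hf.submodular X Y)

theorem ingletonAt_of_spanning_outer (hf : IsPolymatroid f)
    (h : ∀ X, f X ≤ f (A ∪ B)) : IngletonAt f A B C D := by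
  have h₁ := hf.submodular_of_subset (X := B ∪ C) (Y := D ∪ B) (Z := B) (W := D ∪ B ∪ C)
    (by grind) (by grind)
  have h₂ := hf.submodular_of_subset (X := A ∪ C) (Y := D ∪ C) (Z := C) (W := A ∪ D)
    (by grind) (by grind)
  have h₃ := h (A ∪ B ∪ C)
  simp only [IngletonAt]
  linarith

theorem ingletonAt_of_spanning_inner (hf : IsPolymatroid f)
    (h : ∀ X, f X ≤ f (B ∪ C)) : IngletonAt f A B C D := by
  have h₁ := hf.submodular_of_subset (X := A ∪ B) (Y := D ∪ B) (Z := B) (W := A ∪ B ∪ D)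
    (by grind) (by grind)
  have h₂ := hf.submodular_of_subset (X := A ∪ C) (Y := D ∪ C) (Z := C) (W := A ∪ C ∪ D)
    (by grind) (by grind)
  have h₃ := hf.submodular_of_subset (X := A ∪ B ∪ D) (Y := A ∪ C ∪ D) (Z := A ∪ D)
    (W := A ∪ B ∪ C) (by grind) (by grind)
  have h₄ := h (D ∪ B ∪ C)
  simp only [IngletonAt]
  linarith

theorem ingletonAt_of_modular_inner (hf : IsPolymatroid f)
    (h : f B + f C ≤ f (B ∪ C) + f (B ∩ C)) : IngletonAt f A B C D := by
  have h₁ := hf.submodular_of_subset (X := A ∪ B) (Y := A ∪ C) (Z := A ∪ B ∩ C)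
    (W := A ∪ B ∪ C) (by grind) (by grind)
  have h₂ := hf.submodular_of_subset (X := D ∪ B) (Y := D ∪ C) (Z := D ∪ B ∩ C)
    (W := D ∪ B ∪ C) (by grind) (by grind)
  have h₃ := hf.submodular_of_subset (X := A ∪ B ∩ C) (Y := D ∪ B ∩ C) (Z := B ∩ C)
    (W := A ∪ D) (by grind) (by grind)
  simp only [IngletonAt]
  linarith

theorem ingletonAt_of_modular_outer (hf : IsPolymatroid f)
    (h : f A + f B ≤ f (A ∪ B) + f (A ∩ B)) : IngletonAt f A B C D := by
  have h₁ := hf.submodular_of_subset (X := A ∪ C) (Y := B ∪ C) (Z := A ∩ B ∪ C)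
    (W := A ∪ B ∪ C) (by grind) (by grind)
  have h₂ := hf.submodular_of_subset (X := A ∩ B ∪ C) (Y := D ∪ C) (Z := C)
    (W := A ∩ B ∪ C ∪ D) (by grind) (by grind)
  have h₃ := hf.submodular_of_subset (X := A ∩ B ∪ C ∪ D) (Y := D ∪ B) (Z := A ∩ B ∪ D)
    (W := D ∪ B ∪ C) (by grind) (by grind)
  have h₄ := hf.submodular_of_subset (X := A ∩ B ∪ D) (Y := A) (Z := A ∩ B)
    (W := A ∪ D) (by grind) (by grind)
  simp only [IngletonAt]
  linarith

end IsPolymatroid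

end Ingleton

theorem isPolymatroid_realRank {α : Type u} [DecidableEq α] (M : Matroid α) :
    IsPolymatroid M.realRank := by
  have hcast (X : Finset α) : ((M.eRk (X : Set α)).toNat : ℕ∞) = M.eRk (X : Set α) :=
    ENat.natCast_toNat (ne_top_of_le_ne_top X.finite_toSet.encard_lt_top.ne (M.eRk_le_encard X))
  refine ⟨by simp [Matroid.realRank], fun X Y hXY => ?_, fun X Y => ?_⟩
  · have h := M.eRk_mono (coe_subset.2 hXY)
    rw [← hcast X, ← hcast Y] at h
    simp only [Matroid.realRank]
    exact_mod_cast h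
  · have h := M.eRk_inter_add_eRk_union_le (X : Set α) Y
    rw [← coe_inter, ← coe_union, ← hcast X, ← hcast Y, ← hcast (X ∩ Y), ← hcast (X ∪ Y)] at h
    simp only [Matroid.realRank]
    exact_mod_cast h

/-- There is no Vámos configuration in `H`: no set `I` of `d - 4` elements and disjoint pairs
`P₁, …, P₄` such that `I ∪ Pᵢ ∪ Pⱼ` is in `H` for all `i < j` except `(1, 4)`. It is stated for
`X = I ∪ P₁ ∪ P₂`, `Y = I ∪ P₁ ∪ P₃`, `Z = I ∪ P₂ ∪ P₄` and `W = I ∪ P₃ ∪ P₄`, from which `I` and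
the pairs are recovered as intersections. -/
def IsVamosFree {α : Type u} [DecidableEq α] (d : ℕ) (H : Finset (Finset α)) : Prop :=
  ∀ X ∈ H, ∀ W ∈ H, ∀ Y ∈ H, ∀ Z ∈ H, X ∩ W = Y ∩ Z → (X ∩ W).card + 4 = d →
    X ∩ Z ∪ W ∩ Y ∈ H → (X ∩ Y ∪ W ∩ Z).card = d → X ∩ Y ∪ W ∩ Z ∈ H

namespace IsSparseFamily

variable {α : Type u} [DecidableEq α] {d : ℕ} {H : Finset (Finset α)} {A B C D : Finset α}

theorem realRank_of_mem (hH : IsSparseFamily d H) (hA : A ∈ H) :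
    hH.matroid.realRank A = d - 1 := by
  have hne := ne_top_of_le_ne_top (ENat.natCast_ne_top d) (hH.eRk_le A)
  have h := hH.eRk_add_one_of_mem hA
  rw [← ENat.natCast_toNat hne] at h
  rw [Matroid.realRank, eq_sub_iff_add_eq]
  exact_mod_cast h

theorem realRank_of_notMem (hH : IsSparseFamily d H) (hA : A ∉ H) :
    hH.matroid.realRank A = (min A.card d : ℕ) := by
  rw [Matroid.realRank, hH.eRk_of_notMem hA, ENat.toNat_natCast]

theorem realRank_of_card_lt (hH : IsSparseFamily d H) (hA : A.card < d) :
    hH.matroid.realRank A = A.card := by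
  rw [hH.realRank_of_notMem (hH.notMem_of_card_ne hA.ne), min_eq_left hA.le]

theorem realRank_of_lt_card (hH : IsSparseFamily d H) (hA : d < A.card) :
    hH.matroid.realRank A = d := by
  rw [hH.realRank_of_notMem (hH.notMem_of_card_ne hA.ne'), min_eq_right hA.le]

theorem realRank_le (hH : IsSparseFamily d H) (A : Finset α) : hH.matroid.realRank A ≤ d := by
  by_cases hA : A ∈ H
  · rw [hH.realRank_of_mem hA]
    exact sub_le_self _ zero_le_one
  · rw [hH.realRank_of_notMem hA]
    exact_mod_cast min_le_right _ _

theorem realRank_le_card (hH : IsSparseFamily d H) (A : Finset α) :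
    hH.matroid.realRank A ≤ A.card := by
  by_cases hA : A ∈ H
  · rw [hH.realRank_of_mem hA, hH.card_eq A hA]
    exact sub_le_self _ zero_le_one
  · rw [hH.realRank_of_notMem hA]
    exact_mod_cast min_le_left _ _

theorem realRank_le_of_subset_mem (hH : IsSparseFamily d H) (hAB : A ⊆ B) (hB : B ∈ H) :
    hH.matroid.realRank A ≤ d - 1 :=
  hH.realRank_of_mem hB ▸ (isPolymatroid_realRank _).mono _ _ hAB

theorem spanning_or_modular_of_union_notMem (hH : IsSparseFamily d H) (h : A ∪ B ∉ H) :
    (∀ X, hH.matroid.realRank X ≤ hH.matroid.realRank (A ∪ B)) ∨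
      hH.matroid.realRank A + hH.matroid.realRank B ≤
        hH.matroid.realRank (A ∪ B) + hH.matroid.realRank (A ∩ B) := by
  rcases lt_or_ge d (A ∪ B).card with hc | hc
  · exact .inl fun X => hH.realRank_of_lt_card hc ▸ hH.realRank_le X
  · right
    have hi : A ∩ B ∉ H := fun hi => h <| by
      rwa [← eq_of_subset_of_card_le (inter_subset_union (s := A) (t := B))
        (hc.trans_eq (hH.card_eq _ hi).symm)]
    rw [hH.realRank_of_notMem h, hH.realRank_of_notMem hi, min_eq_left hc,
      min_eq_left ((card_le_card inter_subset_union).trans hc)]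
    refine (add_le_add (hH.realRank_le_card A) (hH.realRank_le_card B)).trans ?_
    exact_mod_cast (card_union_add_card_inter A B).ge

theorem ingletonAt_of_outer_union_notMem (hH : IsSparseFamily d H) (h : A ∪ B ∉ H) :
    IngletonAt hH.matroid.realRank A B C D :=
  (hH.spanning_or_modular_of_union_notMem h).elim
    (isPolymatroid_realRank _).ingletonAt_of_spanning_outer
    (isPolymatroid_realRank _).ingletonAt_of_modular_outer

theorem ingletonAt_of_inner_union_notMem (hH : IsSparseFamily d H) (h : B ∪ C ∉ H) :
    IngletonAt hH.matroid.realRank A B C D :=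
  (hH.spanning_or_modular_of_union_notMem h).elim
    (isPolymatroid_realRank _).ingletonAt_of_spanning_inner
    (isPolymatroid_realRank _).ingletonAt_of_modular_inner

theorem ingletonAt_of_lt_card (hH : IsSparseFamily d H) (hAB : A ∪ B ∈ H) (hAC : A ∪ C ∈ H)
    (hDB : D ∪ B ∈ H) (hDC : D ∪ C ∈ H) (hBC : B ∪ C ∈ H) (hB : d < B.card + 2) :
    IngletonAt hH.matroid.realRank A B C D := by
  have hA : A ∪ B = B ∪ C :=
    hH.eq_of_subset hAB hBC subset_union_right subset_union_left hB
  have hD : D ∪ B = B ∪ C :=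
    hH.eq_of_subset hDB hBC subset_union_right subset_union_left hB
  have hle (X : Finset α) (hX : X ⊆ B ∪ C) := hH.realRank_le_of_subset_mem hX hBC
  have h₁ := hle B (by grind)
  have h₂ := hle C (by grind)
  have h₃ := hle (A ∪ B ∪ C) (by grind)
  have h₄ := hle (D ∪ B ∪ C) (by grind)
  have h₅ := hle (A ∪ D) (by grind)
  rw [IngletonAt, hH.realRank_of_mem hAB, hH.realRank_of_mem hAC, hH.realRank_of_mem hDB,
    hH.realRank_of_mem hDC, hH.realRank_of_mem hBC]
  linarith

theorem exists_mem_superset_of_isVamosFree (hH : IsSparseFamily d H) (hV : IsVamosFree d H)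
    (hAB : A ∪ B ∈ H) (hAC : A ∪ C ∈ H) (hDB : D ∪ B ∈ H) (hDC : D ∪ C ∈ H) (hBC : B ∪ C ∈ H)
    (hB : B.card + 2 = d) (hC : C.card + 2 = d) (hA : ∀ X ∈ H, ¬ A ∪ B ∪ C ⊆ X)
    (hD : ∀ X ∈ H, ¬ D ∪ B ∪ C ⊆ X)
    (hcard : d ≤ ((A ∪ B) ∩ (A ∪ C) ∪ (D ∪ C) ∩ (D ∪ B)).card) : ∃ X ∈ H, A ∪ D ⊆ X := by
  by_contra! hAD
  have hABC : (A ∪ B) ∩ (B ∪ C) = B :=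
    hH.inter_eq_of_subset hAB hBC (fun h => hA _ hBC (by grind)) (by grind) (by grind) hB
  have hDBC : (D ∪ B) ∩ (B ∪ C) = B :=
    hH.inter_eq_of_subset hDB hBC (fun h => hD _ hBC (by grind)) (by grind) (by grind) hB
  have hACB : (A ∪ C) ∩ (B ∪ C) = C :=
    hH.inter_eq_of_subset hAC hBC (fun h => hA _ hBC (by grind)) (by grind) (by grind) hC
  have hDCB : (D ∪ C) ∩ (B ∪ C) = C :=
    hH.inter_eq_of_subset hDC hBC (fun h => hD _ hBC (by grind)) (by grind) (by grind) hC
  have hBB : (A ∪ B) ∩ (D ∪ B) = B :=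
    hH.inter_eq_of_subset hAB hDB (fun h => hAD _ hAB (by grind)) (by grind) (by grind) hB
  have hCC : (D ∪ C) ∩ (A ∪ C) = C :=
    hH.inter_eq_of_subset hDC hAC (fun h => hAD _ hAC (by grind)) (by grind) (by grind) hC
  have hcA := hH.card_inter_add_two_le _ hAB _ hAC fun h => hA _ hAB (by grind)
  have hcD := hH.card_inter_add_two_le _ hDC _ hDB fun h => hD _ hDB (by grind)
  have hcBC : (B ∩ C).card + 4 = d := by
    have := card_union_add_card_inter B C
    have := hH.card_eq _ hBC
    omega
  have hsub : B ∩ C ⊆ ((A ∪ B) ∩ (A ∪ C)) ∩ ((D ∪ C) ∩ (D ∪ B)) := by grind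
  have hcAD := card_union_add_card_inter ((A ∪ B) ∩ (A ∪ C)) ((D ∪ C) ∩ (D ∪ B))
  have hle := card_le_card hsub
  have hI : B ∩ C = ((A ∪ B) ∩ (A ∪ C)) ∩ ((D ∪ C) ∩ (D ∪ B)) :=
    eq_of_subset_of_card_le hsub (by omega)
  have hX : (A ∪ B) ∩ (D ∪ C) = B ∩ C := by grind
  have hY : (A ∪ C) ∩ (D ∪ B) = B ∩ C := by grind
  refine hAD _ (hV _ hAB _ hDC _ hAC _ hDB (hX.trans hY.symm) (hX ▸ hcBC) ?_ (by omega)) (by grind)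
  rwa [hBB, hCC]

theorem ingletonAt_of_isVamosFree (hH : IsSparseFamily d H) (hV : IsVamosFree d H)
    (hAB : A ∪ B ∈ H) (hAC : A ∪ C ∈ H) (hDB : D ∪ B ∈ H) (hDC : D ∪ C ∈ H) (hBC : B ∪ C ∈ H) :
    IngletonAt hH.matroid.realRank A B C D := by
  rcases lt_or_ge d (B.card + 2) with hB | hB
  · exact hH.ingletonAt_of_lt_card hAB hAC hDB hDC hBC hB
  rcases lt_or_ge d (C.card + 2) with hC | hC
  · exact (hH.ingletonAt_of_lt_card hAC hAB hDC hDB (union_comm B C ▸ hBC) hC).swap_inner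
  by_contra h
  rw [IngletonAt, hH.realRank_of_mem hAB, hH.realRank_of_mem hAC, hH.realRank_of_mem hDB,
    hH.realRank_of_mem hDC, hH.realRank_of_mem hBC, not_le] at h
  have hB' : (B.card : ℝ) + 2 ≤ d := by exact_mod_cast hB
  have hC' : (C.card : ℝ) + 2 ≤ d := by exact_mod_cast hC
  have hrB := hH.realRank_le_card B
  have hrC := hH.realRank_le_card C
  have hrA := hH.realRank_le (A ∪ B ∪ C)
  have hrD := hH.realRank_le (D ∪ B ∪ C)
  have hrAD := hH.realRank_le (A ∪ D)
  have hsum : 2 * (d : ℝ) < B.card + C.card + 5 := by linarith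
  norm_cast at hsum
  obtain ⟨X, hX, hADX⟩ := hH.exists_mem_superset_of_isVamosFree hV hAB hAC hDB hDC hBC
    (by omega) (by omega)
    (fun X hX hsub => by linarith [hH.realRank_le_of_subset_mem hsub hX])
    (fun X hX hsub => by linarith [hH.realRank_le_of_subset_mem hsub hX]) <| by
      set U := (A ∪ B) ∩ (A ∪ C) ∪ (D ∪ C) ∩ (D ∪ B)
      have hmono := (isPolymatroid_realRank hH.matroid).mono (A ∪ D) U (by grind)
      have hU := hH.realRank_le_card U
      have hlt : (d : ℝ) < U.card + 1 := by linarith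
      exact Nat.lt_succ_iff.1 (by exact_mod_cast hlt)
  linarith [hH.realRank_le_of_subset_mem hADX hX]

theorem isIngletonCompliant (hH : IsSparseFamily d H) (hV : IsVamosFree d H) :
    IsIngletonCompliant hH.matroid.realRank := by
  refine (isPolymatroid_realRank _).isIngletonCompliant fun A B C D => ?_
  by_cases hAB : A ∪ B ∈ H; swap
  · exact hH.ingletonAt_of_outer_union_notMem hAB
  by_cases hAC : A ∪ C ∈ H; swap
  · exact (hH.ingletonAt_of_outer_union_notMem hAC).swap_inner
  by_cases hDB : D ∪ B ∈ H; swap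
  · exact (hH.ingletonAt_of_outer_union_notMem hDB).swap_outer
  by_cases hDC : D ∪ C ∈ H; swap
  · exact (hH.ingletonAt_of_outer_union_notMem hDC).swap_inner.swap_outer
  by_cases hBC : B ∪ C ∈ H; swap
  · exact hH.ingletonAt_of_inner_union_notMem hBC
  exact hH.ingletonAt_of_isVamosFree hV hAB hAC hDB hDC hBC

end IsSparseFamily

/-! ### Common information -/

/-- The set `X` determines the set `Y` if adding `Y` to `X` does not raise the rank. -/
def Determines {Q : Type u} [DecidableEq Q] (f : Finset Q → ℝ) (X Y : Finset Q) : Prop :=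
  f (X ∪ Y) ≤ f X

section CommonInfo

variable {Q : Type u} [DecidableEq Q] {f : Finset Q → ℝ}

namespace Determines

theorem of_subset {X Y : Finset Q} (h : Y ⊆ X) : Determines f X Y := by
  rw [Determines, union_eq_left.2 h]

theorem mono_left (hf : IsPolymatroid f) {X X' Y : Finset Q} (h : Determines f X Y)
    (hX : X ⊆ X') : Determines f X' Y := by
  have hsub := hf.submodular_of_subset (X := X ∪ Y) (Y := X') (Z := X) (W := X' ∪ Y)
    (by grind) (by grind)
  simp only [Determines] at *
  linarith

protected theorem union (hf : IsPolymatroid f) {X Y Z : Finset Q} (hY : Determines f X Y)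
    (hZ : Determines f X Z) : Determines f X (Y ∪ Z) := by
  have h := hZ.mono_left hf (subset_union_left (s₂ := Y))
  rw [Determines, union_assoc] at h
  exact le_trans h hY

protected theorem trans (hf : IsPolymatroid f) {X Y Z : Finset Q} (hY : Determines f X Y)
    (hZ : Determines f Y Z) : Determines f X Z := by
  have h := hZ.mono_left hf (subset_union_right (s₁ := X))
  have hmono := hf.mono (X ∪ Z) (X ∪ Y ∪ Z) (by grind)
  exact hmono.trans (le_trans h hY)

theorem rank_union_add_le (hf : IsPolymatroid f) {Y Z W : Finset Q} (hY : Determines f Y W)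
    (hZ : Determines f Z W) (X : Finset Q) :
    f (X ∪ W) + f (X ∪ Y ∪ Z) ≤ f (X ∪ Y) + f (X ∪ Z) := by
  have h₁ := hY.mono_left hf (subset_union_right (s₁ := X))
  have h₂ := hZ.mono_left hf (subset_union_right (s₁ := X))
  have h₃ := hf.submodular_of_subset (X := X ∪ Y ∪ W) (Y := X ∪ Z ∪ W) (Z := X ∪ W)
    (W := X ∪ Y ∪ Z) (by grind) (by grind)
  simp only [Determines] at h₁ h₂
  linarith

theorem rank_add_le (hf : IsPolymatroid f) {Y Z W : Finset Q} (hY : Determines f Y W)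
    (hZ : Determines f Z W) : f W + f (Y ∪ Z) ≤ f Y + f Z := by
  simpa only [empty_union] using hY.rank_union_add_le hf hZ ∅

end Determines

theorem isCommonInfo_iff {A B X : Finset Q} :
    IsCommonInfo f A B X ↔
      f (A ∪ X) = f A ∧ f (B ∪ X) = f B ∧ f X = f A + f B - f (A ∪ B) - f ∅ := by
  simp only [IsCommonInfo, condRank, mutualRank, condMutual, union_assoc, union_self, empty_union]
  refine and_congr ?_ (and_congr ?_ Iff.rfl) <;> constructor <;> intro h <;> linarith

namespace IsCommonInfo

variable {A B X : Finset Q}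

theorem determines_left (h : IsCommonInfo f A B X) : Determines f A X :=
  (isCommonInfo_iff.1 h).1.le

theorem determines_right (h : IsCommonInfo f A B X) : Determines f B X :=
  (isCommonInfo_iff.1 h).2.1.le

theorem rank_eq (h : IsCommonInfo f A B X) (hf : IsPolymatroid f) :
    f X = f A + f B - f (A ∪ B) := by
  simpa only [hf.map_empty, sub_zero] using (isCommonInfo_iff.1 h).2.2

theorem map_some (h : IsCommonInfo f A B X) {f' : Finset (Option Q) → ℝ}
    (hf' : IsOnePointExtension f f') :
    IsCommonInfo f' (A.map .some) (B.map .some) (X.map .some) := by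
  rw [isCommonInfo_iff] at h ⊢
  rw [← map_empty (.some : Q ↪ Option Q)]
  simpa only [← map_union, hf'.2] using h

end IsCommonInfo

/-- Three rows `R i` and three columns `K j` with the ranks of their pairwise unions that they have
in the tic-tac-toe matroid: a row and a column span a hyperplane, except for the middle ones. -/
structure IsTicTacToeGrid (f : Finset Q → ℝ) (R K : Fin 3 → Finset Q) : Prop where
  rank_row : ∀ i, f (R i) = 3
  rank_col : ∀ j, f (K j) = 3
  rank_row_union_row : ∀ i j, i ≠ j → f (R i ∪ R j) = 5
  rank_col_union_col : ∀ i j, i ≠ j → f (K i ∪ K j) = 5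
  rank_row_union_col : ∀ i j, (i, j) ≠ (1, 1) → f (R i ∪ K j) = 4
  rank_center : f (R 1 ∪ K 1) = 5

namespace IsTicTacToeGrid

variable {R K : Fin 3 → Finset Q} {P q s : Finset Q}

theorem map_some (hG : IsTicTacToeGrid f R K) {f' : Finset (Option Q) → ℝ}
    (hf' : IsOnePointExtension f f') :
    IsTicTacToeGrid f' (fun i => (R i).map .some) fun j => (K j).map .some := by
  constructor <;> simp only [← map_union, hf'.2]
  exacts [hG.rank_row, hG.rank_col, hG.rank_row_union_row, hG.rank_col_union_col,
    hG.rank_row_union_col, hG.rank_center]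

theorem col_determines (hG : IsTicTacToeGrid f R K) (hf : IsPolymatroid f) {i j k : Fin 3}
    (hij : i ≠ j) (hik : (i, k) ≠ (1, 1)) (hjk : (j, k) ≠ (1, 1)) (hi : Determines f (R i) q)
    (hj : Determines f (R j) q) : Determines f (K k) q := by
  have h := hi.rank_union_add_le hf hj (K k)
  have h₅ := hf.mono (R i ∪ R j) (K k ∪ R i ∪ R j) (by grind)
  rw [union_comm (K k) (R j), hG.rank_row_union_col j k hjk, union_comm (K k) (R i),
    hG.rank_row_union_col i k hik] at h
  rw [hG.rank_row_union_row i j hij, union_comm (K k) (R i)] at h₅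
  rw [Determines, hG.rank_col]
  linarith

theorem rank_commonInfo (hG : IsTicTacToeGrid f R K) (hf : IsPolymatroid f) {i j : Fin 3}
    (hij : i ≠ j) (hq : IsCommonInfo f (R i) (R j) q) : f q = 1 := by
  rw [hq.rank_eq hf, hG.rank_row, hG.rank_row, hG.rank_row_union_row i j hij]
  norm_num

theorem commonInfo_determines (hG : IsTicTacToeGrid f R K) (hf : IsPolymatroid f)
    (hq : IsCommonInfo f (R 0) (R 1) q) (hs : IsCommonInfo f (R 0) (R 2) s) :
    Determines f q s := by
  have hcol (k : Fin 3) (hk : k ≠ 1) : Determines f (K k) (q ∪ s) :=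
    .union hf
      (hG.col_determines hf (by decide) (by simp) (by simpa using hk)
        hq.determines_left hq.determines_right)
      (hG.col_determines hf (by decide) (by simp) (by simp)
        hs.determines_left hs.determines_right)
  have h := (hcol 0 (by decide)).rank_add_le hf (hcol 2 (by decide))
  rw [hG.rank_col, hG.rank_col, hG.rank_col_union_col 0 2 (by decide)] at h
  rw [Determines, hG.rank_commonInfo hf (by decide) hq]
  linarith

theorem row_determines_center (hG : IsTicTacToeGrid f R K) (hf : IsPolymatroid f)
    (hq : IsCommonInfo f (R 0) (R 1) q) (hs : IsCommonInfo f (R 0) (R 2) s)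
    (hPR : P ⊆ R 1) (hPK : P ⊆ K 1) : Determines f (R 0) P := by
  have hRow : Determines f (R 1) (s ∪ P) :=
    (hq.determines_right.trans hf (hG.commonInfo_determines hf hq hs)).union hf (.of_subset hPR)
  have hCol : Determines f (K 1) (s ∪ P) :=
    (hG.col_determines hf (by decide) (by simp) (by simp)
      hs.determines_left hs.determines_right).union hf (.of_subset hPK)
  have h := hRow.rank_add_le hf hCol
  rw [hG.rank_row, hG.rank_col, hG.rank_center] at h
  refine hs.determines_left.trans hf ?_
  rw [Determines, hG.rank_commonInfo hf (by decide) hs]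
  linarith

theorem not_isKCICompliant_two (hG : IsTicTacToeGrid f R K) (hPR : P ⊆ R 1) (hPK : P ⊆ K 1)
    (hP : f (R 0) < f (R 0 ∪ P)) : ¬ IsKCICompliant 2 f := by
  intro h
  obtain ⟨f₁, hf₁, hq, h₁⟩ := h (R 0) (R 1)
  obtain ⟨f₂, hf₂, hs, -⟩ := h₁ ((R 0).map .some) ((R 2).map .some)
  have hdet := ((hG.map_some hf₁).map_some hf₂).row_determines_center hf₂.1 (hq.map_some hf₂) hs
    (map_subset_map.2 (map_subset_map.2 hPR)) (map_subset_map.2 (map_subset_map.2 hPK))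
  simp only [Determines, ← map_union, hf₂.2, hf₁.2] at hdet
  exact hdet.not_gt hP

end IsTicTacToeGrid

end CommonInfo

/-! ### Folded linear matroids -/

section ConstMul

variable {Q : Type u} [DecidableEq Q] {f : Finset Q → ℝ} {c : ℝ}

theorem IsPolymatroid.const_mul (hf : IsPolymatroid f) (hc : 0 ≤ c) :
    IsPolymatroid fun X => c * f X where
  map_empty := by rw [hf.map_empty, mul_zero]
  mono X Y hXY := mul_le_mul_of_nonneg_left (hf.mono X Y hXY) hc
  submodular X Y := by
    simpa only [mul_add] using mul_le_mul_of_nonneg_left (hf.submodular X Y) hc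

theorem IsCommonInfo.const_mul {A B X : Finset Q} (h : IsCommonInfo f A B X) (c : ℝ) :
    IsCommonInfo (fun X => c * f X) A B X := by
  obtain ⟨hA, hB, hX⟩ := isCommonInfo_iff.1 h
  exact isCommonInfo_iff.2 ⟨by rw [hA], by rw [hB], by rw [hX]; ring⟩

end ConstMul

theorem IsKCICompliant.const_mul {c : ℝ} (hc : 0 ≤ c) :
    ∀ {k : ℕ} {Q : Type u} [DecidableEq Q] {f : Finset Q → ℝ}, IsKCICompliant k f →
      IsKCICompliant k fun X => c * f X
  | 0, _, _, _, _ => trivial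
  | k + 1, Q, _, f, h => fun A B => by
    obtain ⟨f', ⟨hf', hext⟩, hinfo, hk⟩ := h A B
    exact ⟨fun X => c * f' X, ⟨hf'.const_mul hc, fun X => congrArg (c * ·) (hext X)⟩,
      hinfo.const_mul c, hk.const_mul hc⟩

namespace IsLinearPolymatroid

variable {F : Type v} [Field F]

theorem isPolymatroid {Q : Type u} [DecidableEq Q] {f : Finset Q → ℝ}
    (h : IsLinearPolymatroid F f) : IsPolymatroid f := by
  obtain ⟨V, _, _, _, W, hW⟩ := h
  refine ⟨by simp [hW], fun X Y hXY => ?_, fun X Y => ?_⟩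
  · rw [hW, hW]
    exact_mod_cast Submodule.finrank_mono (biSup_mono fun x hx => hXY hx)
  · rw [hW, hW, hW, hW, Finset.iSup_union]
    have hinf : (⨆ x ∈ X ∩ Y, W x) ≤ (⨆ x ∈ X, W x) ⊓ ⨆ x ∈ Y, W x :=
      le_inf (biSup_mono fun x hx => (mem_inter.1 hx).1) (biSup_mono fun x hx => (mem_inter.1 hx).2)
    have hdim := Submodule.finrank_sup_add_finrank_inf_eq (⨆ x ∈ X, W x) (⨆ x ∈ Y, W x)
    have hle := Submodule.finrank_mono hinf
    norm_cast
    omega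

theorem exists_extension_isCommonInfo {Q : Type u} [DecidableEq Q] {f : Finset Q → ℝ}
    (h : IsLinearPolymatroid F f) (A B : Finset Q) :
    ∃ f' : Finset (Option Q) → ℝ, IsLinearPolymatroid F f' ∧ IsOnePointExtension f f' ∧
      IsCommonInfo f' (A.map .some) (B.map .some) {none} := by
  obtain ⟨V, _, _, _, W, hW⟩ := h
  let S (X : Finset Q) : Submodule F V := ⨆ x ∈ X, W x
  let W' (o : Option Q) : Submodule F V := o.elim (S A ⊓ S B) W
  let dim (U : Submodule F V) : ℝ := Module.finrank F U
  let f' (X : Finset (Option Q)) : ℝ := dim (⨆ x ∈ X, W' x)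
  have hf' : IsLinearPolymatroid F f' := ⟨V, _, _, ‹_›, W', fun _ => rfl⟩
  have hsome (X : Finset Q) : ⨆ x ∈ X.map .some, W' x = S X := by
    simp [S, W', iSup_and, iSup_comm (ι := Option Q)]
  have hnone : ⨆ x ∈ ({none} : Finset (Option Q)), W' x = S A ⊓ S B := by simp [W']
  refine ⟨f', hf', ⟨hf'.isPolymatroid, fun X => ?_⟩, ?_⟩
  · simp only [f', hsome]
    exact (hW X).symm
  · rw [isCommonInfo_iff, hf'.isPolymatroid.map_empty]
    simp only [f', Finset.iSup_union, hsome, hnone]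
    refine ⟨by rw [sup_eq_left.2 inf_le_left], by rw [sup_eq_left.2 inf_le_right], ?_⟩
    rw [sub_zero, eq_sub_iff_add_eq, add_comm]
    simp only [dim]
    exact_mod_cast Submodule.finrank_sup_add_finrank_inf_eq (S A) (S B)

theorem isKCICompliant : ∀ {k : ℕ} {Q : Type u} [DecidableEq Q] {f : Finset Q → ℝ},
    IsLinearPolymatroid F f → IsKCICompliant k f
  | 0, _, _, _, _ => trivial
  | k + 1, Q, _, f, h => fun A B => by
    obtain ⟨f', hf', hext, hinfo⟩ := h.exists_extension_isCommonInfo A B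
    exact ⟨f', hext, hinfo, hf'.isKCICompliant⟩

end IsLinearPolymatroid

theorem IsFoldedLinear.isCICompliant {Q : Type u} [DecidableEq Q] {r : Finset Q → ℝ}
    (h : IsFoldedLinear.{u, v} r) : IsCICompliant r := by
  intro k _
  obtain ⟨F, _, ℓ, hℓ, hlin⟩ := h
  have hℓ' : (ℓ : ℝ) ≠ 0 := by exact_mod_cast hℓ.ne'
  simpa only [inv_mul_cancel_left₀ hℓ'] using
    (hlin.isKCICompliant (k := k)).const_mul (inv_nonneg.2 (Nat.cast_nonneg ℓ))
/-! ### An isomorphism invariant -/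

/-- An isomorphism invariant of a family of sets: the sum over its members of the squared numbers
of ways in which a member is completed to a cover of the ground set by two further members. -/
def coverInvariant {α : Type u} [Fintype α] [DecidableEq α] (H : Finset (Finset α)) : ℕ :=
  ∑ A ∈ H, (∑ B ∈ H, #{C ∈ H | A ∪ B ∪ C = univ}) ^ 2

theorem coverInvariant_map {α : Type u} {β : Type v} [Fintype α] [DecidableEq α] [Fintype β]
    [DecidableEq β] (H : Finset (Finset α)) (e : α ≃ β) :
    coverInvariant (H.map (mapEmbedding e.toEmbedding).toEmbedding) = coverInvariant H := by
  simp only [coverInvariant, sum_map, filter_map, card_map, RelEmbedding.coe_toEmbedding,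
    mapEmbedding_apply, Function.comp_def, ← map_union, ← map_univ_equiv e, map_inj]

/-! ### Sets of cells as binary numbers -/

theorem cellsOf_land (m n : ℕ) : cellsOf (m &&& n) = cellsOf m ∩ cellsOf n := by
  ext q
  simp [cellsOf]

theorem cellsOf_lor (m n : ℕ) : cellsOf (m ||| n) = cellsOf m ∪ cellsOf n := by
  ext q
  simp [cellsOf]

theorem cellsOf_injOn : Set.InjOn cellsOf (Set.Iio 512) := by
  intro m hm n hn h
  refine Nat.eq_of_testBit_eq fun i => ?_
  by_cases hi : i < 9
  · have hbit := Finset.ext_iff.1 h (⟨i / 3, by omega⟩, ⟨i % 3, by omega⟩)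
    simp only [cellsOf, mem_filter, mem_univ, true_and, Nat.div_add_mod] at hbit
    exact Bool.eq_iff_iff.2 hbit
  · have hpow : 2 ^ 9 ≤ 2 ^ i := Nat.pow_le_pow_right (by norm_num) (by omega)
    rw [Nat.testBit_lt_two_pow (hm.trans_le hpow), Nat.testBit_lt_two_pow (hn.trans_le hpow)]

theorem cellsOf_eq_univ_iff {m : ℕ} (hm : m < 512) : cellsOf m = univ ↔ m = 511 := by
  have h : cellsOf 511 = univ := by decide +kernel
  rw [← h]
  exact cellsOf_injOn.eq_iff hm (by norm_num)

/-- The family of sets of cells coded by a list of numbers. -/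
def familyOf (L : List ℕ) : Finset (Finset Cell) :=
  (L.map cellsOf).toFinset

theorem mem_familyOf {L : List ℕ} {A : Finset Cell} :
    A ∈ familyOf L ↔ ∃ a ∈ L, cellsOf a = A := by
  simp [familyOf]

theorem cellsOf_mem_familyOf {L : List ℕ} (hL : ∀ a ∈ L, a < 512) {a : ℕ} (ha : a < 512) :
    cellsOf a ∈ familyOf L ↔ a ∈ L := by
  rw [mem_familyOf]
  refine ⟨?_, fun h => ⟨a, h, rfl⟩⟩
  rintro ⟨b, hb, h⟩
  rwa [← cellsOf_injOn (hL b hb) ha h]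

/-- `coverInvariant` of a family of sets of cells, computed from their codes. -/
def codeInvariant (L : List ℕ) : ℕ :=
  (L.map fun a => (L.map fun b => L.countP fun c => a ||| b ||| c = 511).sum ^ 2).sum

theorem coverInvariant_familyOf {L : List ℕ} (hL : ∀ a ∈ L, a < 512) (hnd : L.Nodup) :
    coverInvariant (familyOf L) = codeInvariant L := by
  have hmap : (L.map cellsOf).Nodup :=
    hnd.map_on fun a ha b hb => (cellsOf_injOn (hL a ha) (hL b hb) ·)
  have hsum (g : Finset Cell → ℕ) :
      ∑ A ∈ familyOf L, g A = (L.map fun a => g (cellsOf a)).sum := by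
    rw [familyOf, List.sum_toFinset g hmap, List.map_map, Function.comp_def]
  simp only [coverInvariant, codeInvariant, hsum]
  refine congrArg List.sum (List.map_congr_left fun a ha => congrArg (· ^ 2) ?_)
  refine congrArg List.sum (List.map_congr_left fun b hb => ?_)
  have hfilter : {C ∈ familyOf L | cellsOf a ∪ cellsOf b ∪ C = univ} =
      ((L.map cellsOf).filter fun C => cellsOf a ∪ cellsOf b ∪ C = univ).toFinset := by
    ext; simp [familyOf]
  rw [hfilter, List.toFinset_card_of_nodup (hmap.filter _), ← List.countP_eq_length_filter,
    List.countP_map]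
  refine List.countP_congr fun c hc => ?_
  have hlt : a ||| b ||| c < 512 :=
    Nat.or_lt_two_pow (n := 9) (Nat.or_lt_two_pow (n := 9) (hL a ha) (hL b hb)) (hL c hc)
  simp only [Function.comp_apply, decide_eq_true_eq, ← cellsOf_lor, cellsOf_eq_univ_iff hlt]

/-- The pairs of codes whose sets of cells together cover the grid. -/
def coveringPairs (L : List ℕ) : List (ℕ × ℕ) :=
  (L ×ˢ L).filter fun p => p.1 ||| p.2 = 511

theorem mem_coveringPairs {L : List ℕ} (hL : ∀ a ∈ L, a < 512)
    (hcard : ∀ a ∈ L, (cellsOf a).card = 5) {a b : ℕ} (ha : a ∈ L) (hb : b ∈ L)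
    (h : (cellsOf a ∩ cellsOf b).card = 1) : (a, b) ∈ coveringPairs L := by
  have huniv : cellsOf (a ||| b) = univ := by
    rw [← card_eq_iff_eq_univ, cellsOf_lor]
    have hunion := card_union_add_card_inter (cellsOf a) (cellsOf b)
    rw [h, hcard a ha, hcard b hb] at hunion
    exact Nat.add_right_cancel hunion
  have hor := (cellsOf_eq_univ_iff (Nat.or_lt_two_pow (n := 9) (hL a ha) (hL b hb))).1 huniv
  simp [coveringPairs, ha, hb, hor]

theorem isSparseFamily_familyOf {L : List ℕ} (hcard : ∀ a ∈ L, (cellsOf a).card = 5)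
    (hinter : L.Pairwise fun a b => (cellsOf (a &&& b)).card ≤ 3) :
    IsSparseFamily 5 (familyOf L) where
  pos := by norm_num
  card_eq A hA := by
    obtain ⟨a, ha, rfl⟩ := mem_familyOf.1 hA
    exact hcard a ha
  card_inter_add_two_le A hA B hB hne := by
    obtain ⟨a, ha, rfl⟩ := mem_familyOf.1 hA
    obtain ⟨b, hb, rfl⟩ := mem_familyOf.1 hB
    have hsymm : Std.Symm fun a b => (cellsOf (a &&& b)).card ≤ 3 :=
      ⟨fun a b h => by rwa [Nat.land_comm]⟩
    have hle := hinter.forall ha hb (ne_of_apply_ne cellsOf hne)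
    rw [cellsOf_land] at hle
    exact Nat.add_le_add_right hle 2

theorem isVamosFree_familyOf {L : List ℕ} (hL : ∀ a ∈ L, a < 512)
    (hcard : ∀ a ∈ L, (cellsOf a).card = 5)
    (hV : ∀ p ∈ coveringPairs L, ∀ q ∈ coveringPairs L, p.1 &&& p.2 = q.1 &&& q.2 →
      p.1 &&& q.2 ||| p.2 &&& q.1 ∈ L → (cellsOf (p.1 &&& q.1 ||| p.2 &&& q.2)).card = 5 →
        p.1 &&& q.1 ||| p.2 &&& q.2 ∈ L) :
    IsVamosFree 5 (familyOf L) := by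
  intro X hX W hW Y hY Z hZ hXW hone hdiag hfive
  obtain ⟨x, hx, rfl⟩ := mem_familyOf.1 hX
  obtain ⟨w, hw, rfl⟩ := mem_familyOf.1 hW
  obtain ⟨y, hy, rfl⟩ := mem_familyOf.1 hY
  obtain ⟨z, hz, rfl⟩ := mem_familyOf.1 hZ
  have hxw := mem_coveringPairs hL hcard hx hw (by omega)
  have hyz := mem_coveringPairs hL hcard hy hz (by rw [← hXW]; omega)
  have hland {a : ℕ} (b : ℕ) (ha : a ∈ L) : a &&& b < 512 := Nat.and_le_left.trans_lt (hL a ha)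
  have hlor {a b c d : ℕ} (ha : a ∈ L) (hc : c ∈ L) : a &&& b ||| c &&& d < 512 :=
    Nat.or_lt_two_pow (n := 9) (hland b ha) (hland d hc)
  simp only [← cellsOf_land, ← cellsOf_lor] at hXW hdiag hfive ⊢
  rw [cellsOf_mem_familyOf hL (hlor hx hw)] at hdiag ⊢
  exact hV _ hxw _ hyz (cellsOf_injOn (hland w hx) (hland z hy) hXW) hdiag hfive

/-! ### The listed matroids -/

/-- The codes of all circuit-hyperplanes of the `k`-th matroid of the list, those of the
tic-tac-toe matroid first. -/
def circuitHyperplaneCodes (k : Fin 171) : List ℕ :=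
  [79, 151, 295, 121, 316, 457, 466, 484] ++
    furtherCodes.get (k.cast furtherCodes_length.symm)

theorem listedCircuitHyperplanes_eq (k : Fin 171) :
    listedCircuitHyperplanes k = familyOf (circuitHyperplaneCodes k) := by
  have h : ticTacToe = familyOf [79, 151, 295, 121, 316, 457, 466, 484] := by decide +kernel
  rw [listedCircuitHyperplanes, h, circuitHyperplaneCodes, familyOf, familyOf, List.map_append,
    List.toFinset_append]

theorem lt_of_mem_circuitHyperplaneCodes :
    ∀ k, ∀ a ∈ circuitHyperplaneCodes k, a < 512 := by
  decide +kernel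

theorem card_cellsOf_of_mem_circuitHyperplaneCodes :
    ∀ k, ∀ a ∈ circuitHyperplaneCodes k, (cellsOf a).card = 5 := by
  decide +kernel

theorem pairwise_circuitHyperplaneCodes :
    ∀ k, (circuitHyperplaneCodes k).Pairwise fun a b => (cellsOf (a &&& b)).card ≤ 3 := by
  decide +kernel

theorem nodup_circuitHyperplaneCodes (k : Fin 171) : (circuitHyperplaneCodes k).Nodup := by
  refine (pairwise_circuitHyperplaneCodes k).imp_of_mem fun {a b} ha _ hab hne => ?_
  rw [← hne, Nat.and_self, card_cellsOf_of_mem_circuitHyperplaneCodes k a ha] at hab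
  norm_num at hab

theorem isSparseFamily_listedCircuitHyperplanes (k : Fin 171) :
    IsSparseFamily 5 (listedCircuitHyperplanes k) := by
  rw [listedCircuitHyperplanes_eq]
  exact isSparseFamily_familyOf (card_cellsOf_of_mem_circuitHyperplaneCodes k)
    (pairwise_circuitHyperplaneCodes k)

theorem isVamosFree_listedCircuitHyperplanes (k : Fin 171) :
    IsVamosFree 5 (listedCircuitHyperplanes k) := by
  rw [listedCircuitHyperplanes_eq]
  refine isVamosFree_familyOf (lt_of_mem_circuitHyperplaneCodes k)
    (card_cellsOf_of_mem_circuitHyperplaneCodes k) ?_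
  revert k
  decide +kernel

theorem coverInvariant_listedCircuitHyperplanes_injective :
    Function.Injective fun k => coverInvariant (listedCircuitHyperplanes k) := by
  have h : (List.ofFn fun k => codeInvariant (circuitHyperplaneCodes k)).Nodup := by
    decide +kernel
  simpa only [listedCircuitHyperplanes_eq, coverInvariant_familyOf
    (lt_of_mem_circuitHyperplaneCodes _) (nodup_circuitHyperplaneCodes _)] using List.nodup_ofFn.1 h

theorem cross_mem_listedCircuitHyperplanes {p : Cell} (hp : p ≠ (1, 1)) (k : Fin 171) :
    cross p ∈ listedCircuitHyperplanes k :=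
  mem_union_left _ (mem_image_of_mem _ (by simpa using hp))

theorem cross_center_notMem_listedCircuitHyperplanes (k : Fin 171) :
    cross (1, 1) ∉ listedCircuitHyperplanes k := by
  have hcross : cross (1, 1) = cellsOf 186 := by decide +kernel
  rw [hcross, listedCircuitHyperplanes_eq,
    cellsOf_mem_familyOf (lt_of_mem_circuitHyperplaneCodes k) (by norm_num)]
  revert k
  decide +kernel

/-- The cells of row `i`. -/
def gridRow (i : Fin 3) : Finset Cell :=
  univ.filter fun q => q.1 = i

/-- The cells of column `j`. -/
def gridCol (j : Fin 3) : Finset Cell :=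
  univ.filter fun q => q.2 = j

theorem gridRow_union_gridCol (i j : Fin 3) : gridRow i ∪ gridCol j = cross (i, j) := by
  rw [gridRow, gridCol, cross, filter_or]

namespace IsSparseFamily

variable {H : Finset (Finset Cell)}

theorem isTicTacToeGrid (hH : IsSparseFamily 5 H) (hcross : ∀ p, p ≠ (1, 1) → cross p ∈ H)
    (hcenter : cross (1, 1) ∉ H) : IsTicTacToeGrid hH.matroid.realRank gridRow gridCol := by
  have hthree {X : Finset Cell} (hX : X.card = 3) : hH.matroid.realRank X = 3 := by
    rw [hH.realRank_of_card_lt (by omega), hX, Nat.cast_ofNat]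
  have hfive {X : Finset Cell} (hX : X.card = 6) : hH.matroid.realRank X = 5 := by
    rw [hH.realRank_of_lt_card (by omega), Nat.cast_ofNat]
  refine ⟨fun i => hthree ?_, fun j => hthree ?_, fun i j hij => hfive ?_, fun i j hij => hfive ?_,
    fun i j hij => ?_, ?_⟩
  iterate 4 · decide +revert
  · rw [gridRow_union_gridCol, hH.realRank_of_mem (hcross _ hij)]
    norm_num
  · have hcard : (cross (1, 1)).card = 5 := by decide
    rw [gridRow_union_gridCol, hH.realRank_of_notMem hcenter, hcard, min_self, Nat.cast_ofNat]

theorem not_isCICompliant (hH : IsSparseFamily 5 H) (hcross : ∀ p, p ≠ (1, 1) → cross p ∈ H)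
    (hcenter : cross (1, 1) ∉ H) : ¬ IsCICompliant hH.matroid.realRank := by
  have hG := hH.isTicTacToeGrid hcross hcenter
  have hcard : (gridRow 0 ∪ {(1, 1)}).card = 4 := by decide
  intro h
  refine hG.not_isKCICompliant_two (P := {(1, 1)}) (by decide) (by decide) ?_ (h 2 one_le_two)
  rw [hG.rank_row, hH.realRank_of_card_lt (by omega), hcard]
  norm_num

end IsSparseFamily

theorem mainTheorem7 :
    ∃ M : Fin 171 → Matroid Cell,
      -- the `k`-th matroid is the sparse paving matroid of rank `5` on the nine cells
      -- with the listed circuit-hyperplanes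
      (∀ k, (M k).E = Set.univ ∧ (M k).eRank = 5 ∧ (M k).IsSparsePaving ∧
        ∀ C : Finset Cell,
          (M k).IsCircuitHyperplane (C : Set Cell) ↔ C ∈ listedCircuitHyperplanes k) ∧
      -- the first one is the tic-tac-toe matroid
      (∀ C : Finset Cell,
        (M 0).IsCircuitHyperplane (C : Set Cell) ↔ ∃ p : Cell, p ≠ (1, 1) ∧ C = cross p) ∧
      -- they are pairwise non-isomorphic
      (∀ k l, (M k).IsIsomorphic (M l) → k = l) ∧
      -- compliance
      (∀ k, IsIngletonCompliant (M k).realRank ∧ ¬ IsCICompliant (M k).realRank) ∧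
      -- none of them is folded linear, over fields in any universe
      (∀ k, ¬ IsFoldedLinear.{0, v} (M k).realRank) := by
  have hH := isSparseFamily_listedCircuitHyperplanes
  have hcard : 5 < Fintype.card Cell := by decide
  have hCI (k) : ¬ IsCICompliant (hH k).matroid.realRank :=
    (hH k).not_isCICompliant (fun _ hp => cross_mem_listedCircuitHyperplanes hp k)
      (cross_center_notMem_listedCircuitHyperplanes k)
  refine ⟨fun k => (hH k).matroid, fun k => ⟨rfl, (hH k).eRank_matroid hcard,
    (hH k).isSparsePaving hcard, fun C => (hH k).isCircuitHyperplane_iff hcard⟩, fun C => ?_,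
    fun k l hkl => ?_, fun k => ⟨?_, hCI k⟩, fun k hk => hCI k hk.isCICompliant⟩
  · have hfirst : listedCircuitHyperplanes 0 = ticTacToe := union_empty _
    rw [(hH 0).isCircuitHyperplane_iff hcard, hfirst]
    simp [ticTacToe, eq_comm]
  · obtain ⟨e, he⟩ := (hH k).exists_equiv_of_isIsomorphic (hH l) hkl
    apply coverInvariant_listedCircuitHyperplanes_injective
    simp only [he, coverInvariant_map]
  · exact (hH k).isIngletonCompliant (isVamosFree_listedCircuitHyperplanes k)
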